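/- Let $\Sigma$ be a finite alphabet with at least two symbols. For $A,B\subseteq\Sigma^*$, say that $A$ and $B$ have the same \emph{p-cardinality} if there are partial functions $f\colon A\to B$ and $g\colon B\to A$ such that $f$ is computable in polynomial time on the inputs in $A$, $g$ is computable in polynomial time on the inputs in $B$, $f\circ g=\mathrm{id}_B$ and $g\circ f=\mathrm{id}_A$ (no condition is imposed on inputs outside $A$, respectively $B$). Say that $A$ and $B$ are \emph{p-isomorphic} if there is a total bijection $f\colon\Sigma^*\to\Sigma^*$ such that $f$ and $f^{-1}$ are computable in polynomial time and $f(A)=B$. The \emph{p-cardinal} of $A$ is the class of all languages over $\Sigma$ having the same p-cardinality as $A$. Then: (1) The p-cardinal of $\Sigma^*$ contains infinitely many distinct p-isomorphism classes. (2) There exist sets $A,B\subseteq\Sigma^*$ that have the same p-cardinality and are not p-isomorphic, such that the complements $\Sigma^*\setminus A$ and $\Sigma^*\setminus B$ are both infinite and in $\mathsf{EXP}=\bigcup_k \mathsf{DTIME}(2^{n^k})$. -/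

import Mathlib

open Turing Computability

/-- A function `f : A → B` between languages `A ⊆ Σ*` and `B ⊆ Γ*` is polynomial-time computable on
`A`: some deterministic multi-stack Turing machine with a polynomial time bound, started on any
`x ∈ A`, halts with output `f x`.  On inputs outside `A` the machine may do anything (output a string,
reject, or not halt), so this is the notion of a partial polynomial-time function `A → B`. -/
def PolyTimeOn {α β : Type} (A : Set (List α)) (B : Set (List β)) (f : A → B) : Prop :=
  Nonempty (TM2ComputableInPolyTime
    (Subtype.val : A → List α) (Subtype.val : B → List β) f)

/-- `A ⊆ Σ*` and `B ⊆ Γ*` have the same p-cardinality: there are partial polynomial-time computable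
functions `f : A → B` and `g : B → A` with `g ∘ f = id_A` and `f ∘ g = id_B`. -/
def PEquipollent {α β : Type} (A : Set (List α)) (B : Set (List β)) : Prop :=
  ∃ (f : A → B) (g : B → A), PolyTimeOn A B f ∧ PolyTimeOn B A g ∧
    f ∘ g = id ∧ g ∘ f = id

/-- A total function `Σ* → Γ*` is computable in polynomial time. -/
def PolyTime {α β : Type} (f : List α → List β) : Prop :=
  Nonempty (TM2ComputableInPolyTime (id : List α → List α) (id : List β → List β) f)

/-- `A ⊆ Σ*` and `B ⊆ Γ*` are p-isomorphic: some total bijection `f : Σ* → Γ*`, computable in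
polynomial time together with its inverse, satisfies `f(A) = B`. -/
def PIsomorphic {α β : Type} (A : Set (List α)) (B : Set (List β)) : Prop :=
  ∃ f : List α ≃ List β, PolyTime f ∧ PolyTime f.symm ∧ f '' A = B

/-- The p-cardinal of `A`: its class under p-equipollence (among languages over the alphabet). -/
def pCardinal {α : Type} (A : Set (List α)) : Set (Set (List α)) :=
  {B | PEquipollent A B}

/-- The p-isomorphism class of `A` (among languages over the alphabet). -/
def pIsoClass {α : Type} (A : Set (List α)) : Set (Set (List α)) :=
  {B | PIsomorphic A B}

open Classical in
/-- `A` is in EXP: membership in `A` is decided by a deterministic machine in time `2 ^ p(n)`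
on inputs of length `n`, for some polynomial `p`. -/
def InEXP {α : Type} (A : Set (List α)) : Prop :=
  ∃ (M : TM2ComputableInTime (id : List α → List α) encodeBool (fun x => decide (x ∈ A)))
    (p : Polynomial ℕ), ∀ n, M.time n ≤ 2 ^ p.eval n

/-! A p-isomorphism also matches the complements, whereas equal p-cardinality ignores them; both
parts exploit this. (1) A finite complement is absorbed by Hilbert's hotel along the powers of one
letter (`pEquipollent_univ_of_finite_compl`), while p-isomorphisms preserve the number of missing
words. Complements of size `n`, for each `n`, thus give distinct classes. (2) Let `A` be the words
outside `a*` and `B` those of them not beginning with `b`. Prepending `a` on `a* b Σ*` carries `A`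
onto `B`. But `Aᶜ = a*` has one word per length, while `Bᶜ ⊇ bΣ*` is exponentially dense; a
polynomial-time map has polynomially bounded output length (`PolyTime.exists_length_le`), so it
cannot inject `Bᶜ` into `a*`. All maps used edit a bounded prefix as dictated by a finite automaton,
so the single linear-time machine of `editMachineOutputs` gives every upper bound. -/

/-! ### Block edits and stack growth for single statements -/

namespace Turing.TM2.Stmt

variable {K : Type} {Γ : K → Type} {Λ σ : Type}

/-- Discard the top `n` symbols of stack `k`, then continue with `q`. -/
def dropThen (k : K) (n : ℕ) (q : Stmt Γ Λ σ) : Stmt Γ Λ σ :=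
  (pop k fun v _ => v)^[n] q

/-- Put the word `l` on top of stack `k`, then continue with `q`. -/
def appendThen (k : K) (l : List (Γ k)) (q : Stmt Γ Λ σ) : Stmt Γ Λ σ :=
  l.foldl (fun q c => push k (fun _ => c) q) q

theorem stepAux_dropThen [DecidableEq K] (k : K) (n : ℕ) (q : Stmt Γ Λ σ) (v : σ)
    (S : ∀ k, List (Γ k)) :
    stepAux (dropThen k n q) v S = stepAux q v (Function.update S k ((S k).drop n)) := by
  induction n generalizing S with
  | zero => simp [dropThen]
  | succ n ih =>
    rw [dropThen, Function.iterate_succ_apply', ← dropThen, stepAux, ih]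
    simp [List.drop_tail]

theorem stepAux_appendThen [DecidableEq K] (k : K) (l : List (Γ k)) (q : Stmt Γ Λ σ) (v : σ)
    (S : ∀ k, List (Γ k)) :
    stepAux (appendThen k l q) v S = stepAux q v (Function.update S k (l ++ S k)) := by
  induction l generalizing q with
  | nil => simp [appendThen]
  | cons c l ih =>
    rw [appendThen, List.foldl_cons, ← appendThen, ih]
    simp

/-- The largest number of symbols that a single execution of a statement can push. -/
def pushBound : Stmt Γ Λ σ → ℕ
  | push _ _ q => pushBound q + 1
  | peek _ _ q => pushBound q
  | pop _ _ q => pushBound q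
  | load _ q => pushBound q
  | branch _ q₁ q₂ => max (pushBound q₁) (pushBound q₂)
  | goto _ => 0
  | halt => 0

theorem length_stepAux_le [DecidableEq K] (q : Stmt Γ Λ σ) (v : σ) (S : ∀ k, List (Γ k)) (k : K) :
    ((stepAux q v S).stk k).length ≤ (S k).length + pushBound q := by
  induction q generalizing v S with
  | push k' f q ih =>
    refine (ih _ _).trans ?_
    rcases eq_or_ne k k' with rfl | h
    · simp only [Function.update_self, List.length_cons, pushBound]; omega
    · simp only [Function.update_of_ne h, pushBound]; omega
  | peek k' f q ih => exact ih _ _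
  | pop k' f q ih =>
    refine (ih _ _).trans ?_
    rcases eq_or_ne k k' with rfl | h
    · simp [pushBound]
    · simp [pushBound, h]
  | load f q ih => exact ih _ _
  | branch f q₁ q₂ ih₁ ih₂ =>
    have h₁ := ih₁ v S
    have h₂ := ih₂ v S
    simp only [stepAux, pushBound]
    cases f v <;> simp only [cond_true, cond_false] <;> omega
  | goto f => simp [pushBound]
  | halt => simp [pushBound]

end Turing.TM2.Stmt

/-! ### Stack growth along runs, and a linear-time editing machine -/

namespace Turing

open StateTransition TM2.Stmt

/-- A machine has finitely many labels, so the push bounds of its statements have a maximum. -/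
theorem FinTM2.exists_length_step_le (tm : FinTM2) :
    ∃ C, ∀ c c' : tm.Cfg, tm.step c = some c' →
      ∀ k, (c'.stk k).length ≤ (c.stk k).length + C := by
  have := tm.ΛFin
  refine ⟨Finset.univ.sup fun l => pushBound (tm.m l), ?_⟩
  rintro ⟨_ | l, v, S⟩ c' h k
  · cases h
  · cases h
    refine (length_stepAux_le _ _ _ _).trans ?_
    exact Nat.add_le_add_left
      (Finset.le_sup (f := fun l => pushBound (tm.m l)) (Finset.mem_univ l)) _

theorem FinTM2.exists_length_iterate_le (tm : FinTM2) :
    ∃ C, ∀ (n : ℕ) (c c' : tm.Cfg), (flip bind tm.step)^[n] (some c) = some c' →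
      ∀ k, (c'.stk k).length ≤ (c.stk k).length + n * C := by
  obtain ⟨C, hC⟩ := tm.exists_length_step_le
  refine ⟨C, fun n => ?_⟩
  induction n with
  | zero =>
    rintro c c' h k
    cases h
    simp
  | succ n ih =>
    intro c c' h k
    rw [Function.iterate_succ_apply'] at h
    obtain ⟨d, hd, hd'⟩ : ∃ d, (flip bind tm.step)^[n] (some c) = some d ∧ tm.step d = some c' := by
      cases e : (flip bind tm.step)^[n] (some c) with
      | none => rw [e] at h; cases h
      | some d => rw [e] at h; exact ⟨d, rfl, h⟩
    have h₁ := ih c d hd k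
    have h₂ := hC d c' hd' k
    rw [Nat.succ_mul]
    omega

theorem initList_stk_length_le (tm : FinTM2) (s : List (tm.Γ tm.k₀)) (k : tm.K) :
    ((initList tm s).stk k).length ≤ s.length := by
  by_cases h : k = tm.k₀
  · subst h
    simp [initList]
  · simp [initList, h]

theorem haltList_stk_output (tm : FinTM2) (s : List (tm.Γ tm.k₁)) :
    (haltList tm s).stk tm.k₁ = s := by
  simp [haltList]

/-- Stack alphabets of `editMachine`: an input stack, an auxiliary stack and an output stack. -/
def editAlphabet (α β : Type) : Option Bool → Type
  | none => α
  | some false => α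
  | some true => β

/-- Stack contents of `editMachine`. -/
def editStacks {α β : Type} (x t : List α) (y : List β) : ∀ k, List (editAlphabet α β k)
  | none => x
  | some false => t
  | some true => y

section EditMachine

variable {α β Q : Type}

theorem update_editStacks_input (x t : List α) (y : List β) (x' : List α) :
    Function.update (editStacks x t y) none x' = editStacks x' t y := by
  funext k; rcases k with _ | _ | _ <;> rfl

theorem update_editStacks_aux (x t : List α) (y : List β) (t' : List α) :
    Function.update (editStacks x t y) (some false) t' = editStacks x t' y := by
  funext k; rcases k with _ | _ | _ <;> rfl

theorem update_editStacks_output (x t : List α) (y : List β) (y' : List β) :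
    Function.update (editStacks x t y) (some true) y' = editStacks x t y' := by
  funext k; rcases k with _ | _ | _ <;> rfl

variable [Inhabited α] [Inhabited β]

/-- The program of `editMachine`. -/
def editProgram (δ : Q → α → Q) (κ : α → Option β) (l : Q → List β) (d : Q → ℕ) :
    Q ⊕ Q → TM2.Stmt (editAlphabet α β) (Q ⊕ Q) (Option α)
  | .inl q =>
    pop none (fun _ o => o) <|
      branch Option.isSome
        (push (some false) (fun o : Option α => (o.getD default : α)) <|
          goto fun o => .inl (δ q (o.getD default)))
        (goto fun _ => .inr q)
  | .inr q =>
    pop (some false) (fun _ o => o) <|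
      branch Option.isSome
        (branch (fun o => (o.bind κ).isSome)
          (push (some true) (fun o : Option α => ((o.bind κ).getD default : β)) <|
            goto fun _ => .inr q)
          (goto fun _ => .inr q))
        (dropThen (some true) (d q) <| appendThen (some true) (l q) halt)

/-- A machine that runs a finite automaton over the input, translates the input letter by letter,
and then edits the beginning of the result in a way determined by the final state. -/
def editMachine [Fintype α] [Fintype Q] (δ : Q → α → Q) (q₀ : Q) (κ : α → Option β)
    (l : Q → List β) (d : Q → ℕ) : FinTM2 where
  K := Option Bool
  k₀ := none
  k₁ := some true
  Γ := editAlphabet α β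
  Λ := Q ⊕ Q
  main := .inl q₀
  σ := Option α
  initialState := none
  Γk₀Fin := inferInstanceAs (Fintype α)
  m := editProgram δ κ l d

variable (δ : Q → α → Q) (κ : α → Option β) (l : Q → List β) (d : Q → ℕ)

theorem step_scan_cons (q : Q) (v : Option α) (c : α) (x t : List α) :
    TM2.step (editProgram δ κ l d) ⟨some (.inl q), v, editStacks (c :: x) t []⟩ =
      some ⟨some (.inl (δ q c)), some c, editStacks x (c :: t) []⟩ := by
  simp only [TM2.step, editProgram, TM2.stepAux]
  have h : (editStacks (β := β) (c :: x) t [] none).head? = some c := rfl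
  have h' : Function.update (editStacks (β := β) (c :: x) t []) none
      (editStacks (β := β) (c :: x) t [] none).tail = editStacks x t [] :=
    update_editStacks_input ..
  rw [h, h']
  exact congrArg some (congrArg _ (update_editStacks_aux ..))

theorem step_scan_nil (q : Q) (v : Option α) (t : List α) :
    TM2.step (editProgram δ κ l d) ⟨some (.inl q), v, editStacks [] t []⟩ =
      some ⟨some (.inr q), none, editStacks [] t []⟩ := by
  simp only [TM2.step, editProgram, TM2.stepAux]
  have h : (editStacks (β := β) [] t [] none).head? = (none : Option α) := rfl
  have h' : Function.update (editStacks (β := β) [] t []) none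
      (editStacks (β := β) [] t [] none).tail = editStacks [] t [] :=
    update_editStacks_input ..
  rw [h, h']
  rfl

theorem step_copy_cons (q : Q) (v : Option α) (c : α) (t : List α) (y : List β) :
    TM2.step (editProgram δ κ l d) ⟨some (.inr q), v, editStacks [] (c :: t) y⟩ =
      some ⟨some (.inr q), some c, editStacks [] t ((κ c).toList ++ y)⟩ := by
  simp only [TM2.step, editProgram, TM2.stepAux]
  have h : (editStacks (β := β) [] (c :: t) y (some false)).head? = some c := rfl
  have h' : Function.update (editStacks [] (c :: t) y) (some false)
      (editStacks [] (c :: t) y (some false)).tail = editStacks [] t y :=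
    update_editStacks_aux ..
  rw [h, h']
  cases e : κ c with
  | none => simp [e]
  | some b =>
    simp only [Option.bind_some, e, Option.isSome_some, cond_true, Option.getD_some,
      Option.toList_some, List.singleton_append]
    exact congrArg some (congrArg _ (update_editStacks_output ..))

theorem step_copy_nil (q : Q) (v : Option α) (y : List β) :
    TM2.step (editProgram δ κ l d) ⟨some (.inr q), v, editStacks [] [] y⟩ =
      some ⟨none, none, editStacks [] [] (l q ++ y.drop (d q))⟩ := by
  simp only [TM2.step, editProgram, TM2.stepAux]
  have h : (editStacks (α := α) (β := β) [] [] y (some false)).head? = none := rfl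
  have h' : Function.update (editStacks [] [] y) (some false)
      (editStacks (α := α) (β := β) [] [] y (some false)).tail = editStacks [] [] y :=
    update_editStacks_aux ..
  rw [h, h']
  refine congrArg some (Eq.trans (stepAux_dropThen ..) ((stepAux_appendThen ..).trans ?_))
  rw [Function.update_idem, Function.update_self]
  exact congrArg _ (update_editStacks_output ..)

theorem iterate_scan (x t : List α) (q : Q) (v : Option α) :
    (flip bind (TM2.step (editProgram δ κ l d)))^[x.length + 1]
        (some ⟨some (.inl q), v, editStacks x t []⟩) =
      some ⟨some (.inr (x.foldl δ q)), none, editStacks [] (x.reverse ++ t) []⟩ := by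
  induction x generalizing t q v with
  | nil => exact step_scan_nil ..
  | cons c x ih =>
    rw [List.length_cons, Function.iterate_succ_apply]
    have h : flip bind (TM2.step (editProgram δ κ l d))
        (some ⟨some (.inl q), v, editStacks (c :: x) t []⟩) = _ := step_scan_cons ..
    rw [h, ih]
    simp

/-- The second pass undoes the reversal made by the scan, so the first letter ends on top of the
output stack and the prefix edit fits into the halting step. -/
theorem iterate_copy (t : List α) (y : List β) (q : Q) (v : Option α) :
    (flip bind (TM2.step (editProgram δ κ l d)))^[t.length + 1]
        (some ⟨some (.inr q), v, editStacks [] t y⟩) =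
      some ⟨none, none,
        editStacks [] [] (l q ++ (t.reverse.filterMap κ ++ y).drop (d q))⟩ := by
  induction t generalizing y v with
  | nil => exact step_copy_nil ..
  | cons c t ih =>
    rw [List.length_cons, Function.iterate_succ_apply]
    have h : flip bind (TM2.step (editProgram δ κ l d))
        (some ⟨some (.inr q), v, editStacks [] (c :: t) y⟩) = _ := step_copy_cons ..
    rw [h, ih]
    cases e : κ c <;> simp [e]

/-- `editMachine` runs in linear time. -/
def editMachineOutputs [Fintype α] [Fintype Q] (q₀ : Q) (x : List α) :
    TM2OutputsInTime (editMachine δ q₀ κ l d) x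
      (some (l (x.foldl δ q₀) ++ (x.filterMap κ).drop (d (x.foldl δ q₀))))
      (2 * x.length + 2) where
  steps := (x.length + 1) + (x.length + 1)
  evals_in_steps := by
    rw [Function.iterate_add_apply]
    have h₁ : initList (editMachine δ q₀ κ l d) x =
        ⟨some (.inl q₀), none, editStacks x [] []⟩ := by
      unfold initList
      congr 1
      funext k; rcases k with _ | _ | _ <;> rfl
    have h₂ (y : List β) : haltList (editMachine δ q₀ κ l d) y =
        ⟨none, none, editStacks [] [] y⟩ := by
      unfold haltList
      congr 1
      funext k; rcases k with _ | _ | _ <;> rfl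
    rw [h₁]
    refine Eq.trans ?_ (congrArg some (h₂ _).symm)
    have h := iterate_scan δ κ l d x [] q₀ none
    have h' := iterate_copy δ κ l d x.reverse [] (x.foldl δ q₀) none
    rw [List.append_nil] at h
    rw [List.length_reverse, List.reverse_reverse, List.append_nil] at h'
    exact (congrArg _ h).trans h'
  steps_le_m := by omega

end EditMachine

end Turing

/-! ### Automatic functions and their complexity -/

/-- The value of `s` on a word is computed by a deterministic automaton with state set `Q`. -/
def IsAutomatic {α Q : Type} (s : List α → Q) : Prop :=
  ∃ δ : Q → α → Q, ∀ x c, s (x ++ [c]) = δ (s x) c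

theorem foldl_eq_of_append_singleton {α Q : Type} {s : List α → Q} {δ : Q → α → Q}
    (h : ∀ x c, s (x ++ [c]) = δ (s x) c) (x : List α) : x.foldl δ (s []) = s x := by
  induction x using List.reverseRecOn with
  | nil => rfl
  | append_singleton x c ih => simp [ih, h]

theorem IsAutomatic.prodMk {α Q R : Type} {s : List α → Q} {t : List α → R}
    (hs : IsAutomatic s) (ht : IsAutomatic t) : IsAutomatic fun x => (s x, t x) := by
  obtain ⟨δ, hδ⟩ := hs
  obtain ⟨ε, hε⟩ := ht
  exact ⟨fun q c => (δ q.1 c, ε q.2 c), fun x c => by simp [hδ, hε]⟩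

theorem isAutomatic_find? {α : Type} (p : α → Bool) : IsAutomatic (List.find? p) :=
  ⟨fun o c => o.or (if p c then some c else none), fun x c => by
    rw [List.find?_append]
    cases h : p c <;> simp [h]⟩

theorem isAutomatic_take {α : Type} (N : ℕ) :
    IsAutomatic fun x : List α => (⟨x.take N, by simp⟩ : {l : List α // l.length ≤ N}) :=
  ⟨fun t c => ⟨(t.1 ++ [c]).take N, by simp⟩, fun x c => by
    ext1
    simp only [List.take_append, List.take_take, List.length_take, min_self]
    congr 2
    omega⟩

theorem isAutomatic_head? {α : Type} : IsAutomatic (List.head? : List α → Option α) :=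
  ⟨fun o c => o.or (some c), fun x c => by cases x <;> simp⟩

/-- `F` replaces a bounded initial segment of the word by another word; the replacement is
determined by the state of a finite automaton that has read the whole word. -/
def IsAutomaticEdit {α : Type} (F : List α → List α) : Prop :=
  ∃ (Q : Type) (_ : Fintype Q) (s : List α → Q) (l : Q → List α) (d : Q → ℕ),
    IsAutomatic s ∧ ∀ x, F x = l (s x) ++ x.drop (d (s x))

section Linear

open Turing

variable {α : Type} [Fintype α] [Inhabited α]

theorem IsAutomaticEdit.polyTimeOn {F : List α → List α} (hF : IsAutomaticEdit F)
    {A B : Set (List α)} (f : A → B) (hf : ∀ x, (f x).1 = F x.1) : PolyTimeOn A B f := by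
  obtain ⟨Q, _, s, l, d, ⟨δ, hδ⟩, hs⟩ := hF
  refine ⟨⟨⟨editMachine δ (s []) (some : α → Option α) l d, Equiv.refl _, Equiv.refl _⟩,
    2 * Polynomial.X + 2, fun x => ?_⟩⟩
  have h := editMachineOutputs δ (some : α → Option α) l d (s []) x.1
  rw [foldl_eq_of_append_singleton hδ, List.filterMap_some, ← hs, ← hf] at h
  have e : (2 * Polynomial.X + 2 : Polynomial ℕ).eval x.1.length = 2 * x.1.length + 2 := by
    simp
  rw [e]
  exact (List.map_id x.1).symm ▸ (List.map_id (f x).1).symm ▸ h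

theorem pEquipollent_of_isAutomaticEdit {F G : List α → List α} (hF : IsAutomaticEdit F)
    (hG : IsAutomaticEdit G) {A B : Set (List α)} (hAB : Set.MapsTo F A B)
    (hBA : Set.MapsTo G B A) (hGF : Set.LeftInvOn G F A) (hFG : Set.LeftInvOn F G B) :
    PEquipollent A B :=
  ⟨hAB.restrict, hBA.restrict, hF.polyTimeOn _ fun _ => rfl, hG.polyTimeOn _ fun _ => rfl,
    funext fun x => Subtype.ext (hFG x.2), funext fun x => Subtype.ext (hGF x.2)⟩

open Classical in
theorem IsAutomatic.inEXP {Q : Type} [Fintype Q] {s : List α → Q} (hs : IsAutomatic s)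
    (P : Set Q) : InEXP (s ⁻¹' P) := by
  obtain ⟨δ, hδ⟩ := hs
  -- Translating every letter to `none` erases the input, leaving only the verdict read off the
  -- final state.
  refine ⟨⟨⟨editMachine δ (s []) (fun _ => (none : Option Bool))
    (fun q => [decide (q ∈ P)]) (fun _ => 0), Equiv.refl _, Equiv.refl _⟩,
    fun n => 2 * n + 2, fun x => ?_⟩, Polynomial.X + 1, fun n => ?_⟩
  · have h := editMachineOutputs δ (fun _ => (none : Option Bool))
      (fun q => [decide (q ∈ P)]) (fun _ => 0) (s []) x
    rw [foldl_eq_of_append_singleton hδ] at h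
    have e : [decide (s x ∈ P)] ++
        (x.filterMap fun _ => (none : Option Bool)).drop 0 =
        List.map (Equiv.refl Bool).invFun (Computability.encodeBool (decide (x ∈ s ⁻¹' P))) := by
      have : (x.filterMap fun _ => (none : Option Bool)) = [] := by simp
      rw [this]
      rfl
    rw [e] at h
    exact (List.map_id x).symm ▸ h
  · have : n < 2 ^ n := Nat.lt_two_pow_self
    simp only [Polynomial.eval_add, Polynomial.eval_X, Polynomial.eval_one, pow_succ]
    omega

end Linear

/-- Each step lengthens a stack by at most a constant `C`, so the output exceeds the input by at
most `C` times the running time. -/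
theorem PolyTime.exists_length_le {α β : Type} {f : List α → List β} (hf : PolyTime f) :
    ∃ p : Polynomial ℕ, ∀ x, (f x).length ≤ p.eval x.length := by
  obtain ⟨M⟩ := hf
  obtain ⟨C, hC⟩ := M.tm.exists_length_iterate_le
  refine ⟨Polynomial.X + M.time * Polynomial.C C, fun x => ?_⟩
  have h := hC _ _ _ (M.outputsFun x).evals_in_steps M.tm.k₁
  have h₁ := Turing.initList_stk_length_le M.tm (List.map M.inputAlphabet.invFun (id x)) M.tm.k₁
  have h₂ := Nat.mul_le_mul_right C (M.outputsFun x).steps_le_m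
  rw [Turing.haltList_stk_output] at h
  simp only [List.length_map, id] at h h₁ h₂
  simp only [Polynomial.eval_add, Polynomial.eval_X, Polynomial.eval_mul, Polynomial.eval_C]
  omega

theorem isAutomatic_decide_eq_replicate {α : Type} [DecidableEq α] (a : α) :
    IsAutomatic fun x : List α => decide (x = List.replicate x.length a) :=
  ⟨fun b c => b && decide (c = a), fun x c => by
    simp [List.eq_replicate_iff, or_imp, forall_and]⟩

noncomputable instance fintypeListLengthLe {α : Type} [Finite α] (N : ℕ) :
    Fintype {l : List α // l.length ≤ N} :=
  have : Finite {l : List α // l.length ≤ N} := (List.finite_length_le α N).to_subtype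
  Fintype.ofFinite _

/-! ### Hilbert's hotel and the p-cardinal of `Σ*` -/

section Hotel

variable {α : Type} [DecidableEq α]

/-- Hilbert's hotel in the words `a ^ j`, `N ≤ j`, making room for the words of `S`, where `i`
enumerates the `n` elements of `S`. -/
def hotel (a : α) (N n : ℕ) (S : Finset (List α)) (i : List α → ℕ) (x : List α) : List α :=
  if x ∈ S then List.replicate (N + i x) a
  else if x = List.replicate x.length a ∧ N ≤ x.length then List.replicate n a ++ x
  else x

/-- The inverse of `hotel`, where `w` is the inverse of the enumeration. -/
def hotelInv (a : α) (N n : ℕ) (w : ℕ → List α) (y : List α) : List α :=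
  if y = List.replicate y.length a ∧ N ≤ y.length then
    if y.length < N + n then w (y.length - N) else y.drop n
  else y

variable (a : α) {N n : ℕ} {S : Finset (List α)} {i : List α → ℕ} {w : ℕ → List α}

theorem isAutomaticEdit_hotel [Finite α] (hN : ∀ x ∈ S, x.length < N) :
    IsAutomaticEdit (hotel a N n S i) := by
  refine ⟨_, inferInstance, _,
    fun q => if q.1.1 ∈ S then List.replicate (N + i q.1.1) a
      else if q.2 = true ∧ N ≤ q.1.1.length then List.replicate n a else [],
    -- Words of `S` are shorter than `N`, so dropping `N` letters erases them entirely.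
    fun q => if q.1.1 ∈ S then N else 0,
    (isAutomatic_take N).prodMk (isAutomatic_decide_eq_replicate a), fun x => ?_⟩
  by_cases hx : x ∈ S
  · have h : x.take N = x := List.take_of_length_le (hN x hx).le
    simp [hotel, h, hx, (hN x hx).le]
  · have h : x.take N ∉ S := fun h => by
      have := hN _ h
      rw [List.length_take] at this
      rw [List.take_of_length_le (by omega)] at h
      exact hx h
    simp only [hotel, hx, h, if_false, List.length_take, decide_eq_true_eq, le_min_iff, le_refl,
      true_and, List.drop_zero]
    split_ifs <;> rfl

theorem isAutomaticEdit_hotelInv [Finite α] : IsAutomaticEdit (hotelInv a N n w) := by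
  refine ⟨_, inferInstance, _,
    fun q => if q.2 = true ∧ N ≤ q.1.1.length ∧ q.1.1.length < N + n then w (q.1.1.length - N)
      else [],
    fun q => if q.2 = true ∧ N ≤ q.1.1.length then
      if q.1.1.length < N + n then N + n else n else 0,
    -- A prefix of length `N + n` is just long enough to decide whether `y.length < N + n`.
    (isAutomatic_take (N + n)).prodMk (isAutomatic_decide_eq_replicate a), fun y => ?_⟩
  simp only [hotelInv, List.length_take, decide_eq_true_eq]
  by_cases h : y = List.replicate y.length a
  · by_cases h₁ : N ≤ y.length
    · by_cases h₂ : y.length < N + n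
      · have h₃ : min (N + n) y.length = y.length := by omega
        simp [← h, h₁, h₂, h₂.le]
      · have h₃ : min (N + n) y.length = N + n := by omega
        simp [← h, h₁, h₂, h₃]
    · have h₃ : ¬ N ≤ min (N + n) y.length := by omega
      simp [h₁, h₃]
  · simp [h]

theorem hotel_notMem (hN : ∀ x ∈ S, x.length < N) (x : List α) :
    hotel a N n S i x ∉ S := by
  unfold hotel
  split_ifs with h₁ h₂
  · exact fun h => by simpa using hN _ h
  · intro h
    have := hN _ h
    rw [List.length_append] at this
    omega
  · exact h₁

theorem hotelInv_hotel (hi : ∀ x ∈ S, i x < n ∧ w (i x) = x)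
    (x : List α) : hotelInv a N n w (hotel a N n S i x) = x := by
  unfold hotel
  split_ifs with h₁ h₂
  · simp [hotelInv, hi x h₁]
  · obtain ⟨h₂, h₃⟩ := h₂
    have h₄ : List.replicate n a ++ x =
        List.replicate (List.replicate n a ++ x).length a := by
      conv_lhs => rw [h₂]
      simp
    rw [hotelInv, if_pos ⟨h₄, by simp; omega⟩, if_neg (by simp; omega)]
    simp
  · rw [hotelInv, if_neg h₂]

theorem hotel_hotelInv (hN : ∀ x ∈ S, x.length < N) (hw : ∀ j < n, w j ∈ S ∧ i (w j) = j)
    {y : List α} (hy : y ∉ S) : hotel a N n S i (hotelInv a N n w y) = y := by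
  unfold hotelInv
  split_ifs with h₁ h₂
  · have h := hw (y.length - N) (by omega)
    rw [hotel, if_pos h.1, h.2]
    conv_rhs => rw [h₁.1]
    congr 1
    omega
  · obtain ⟨m, hm⟩ : ∃ m, y.length = n + m := ⟨y.length - n, by omega⟩
    have h₃ : y.drop n = List.replicate m a := by
      rw [h₁.1, hm]
      simp
    have h₄ : List.replicate m a ∉ S := fun h => by
      have := hN _ h
      rw [List.length_replicate] at this
      omega
    rw [h₃, hotel, if_neg h₄, if_pos ⟨by simp, by simp; omega⟩, h₁.1, hm, List.replicate_add]
  · rw [hotel, if_neg hy, if_neg h₁]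

end Hotel

theorem pEquipollent_univ_of_finite_compl {α : Type} [Fintype α] [Nonempty α] {B : Set (List α)}
    (hB : Bᶜ.Finite) : PEquipollent (Set.univ : Set (List α)) B := by
  classical
  inhabit α
  set S : Finset (List α) := hB.toFinset with hS
  have hSB (x : List α) : x ∈ S ↔ x ∉ B := by simp [hS]
  have hN (x : List α) (hx : x ∈ S) : x.length < S.sup List.length + 1 :=
    Nat.lt_succ_of_le (Finset.le_sup (f := List.length) hx)
  let i : List α → ℕ := fun x => if h : x ∈ S then S.equivFin ⟨x, h⟩ else 0
  let w : ℕ → List α := fun j => if h : j < S.card then S.equivFin.symm ⟨j, h⟩ else []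
  have hi (x : List α) (hx : x ∈ S) : i x < S.card ∧ w (i x) = x := by simp [i, w, hx]
  have hw (j : ℕ) (hj : j < S.card) : w j ∈ S ∧ i (w j) = j := by simp [i, w, hj]
  refine pEquipollent_of_isAutomaticEdit (isAutomaticEdit_hotel default (n := S.card) (i := i) hN)
    (isAutomaticEdit_hotelInv default (w := w)) (fun x _ => ?_) (fun _ _ => trivial)
    (fun x _ => hotelInv_hotel default hi x)
    (fun y hy => hotel_hotelInv default hN hw fun h => (hSB y).1 h hy)
  exact not_not.1 fun h => hotel_notMem default hN x ((hSB _).2 h)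

theorem PIsomorphic.refl {α : Type} [Fintype α] (A : Set (List α)) : PIsomorphic A A :=
  ⟨Equiv.refl _, ⟨idComputableInPolyTime _⟩, ⟨idComputableInPolyTime _⟩, by simp⟩

theorem PIsomorphic.exists_image_compl {α β : Type} {A : Set (List α)} {B : Set (List β)}
    (h : PIsomorphic A B) : ∃ f : List α ≃ List β, PolyTime f ∧ PolyTime f.symm ∧ f '' Aᶜ = Bᶜ := by
  obtain ⟨f, hf, hf', rfl⟩ := h
  exact ⟨f, hf, hf', Set.image_compl_eq f.bijective⟩

theorem PIsomorphic.encard_compl_eq {α β : Type} {A : Set (List α)} {B : Set (List β)}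
    (h : PIsomorphic A B) : Aᶜ.encard = Bᶜ.encard := by
  obtain ⟨f, -, -, hf⟩ := h.exists_image_compl
  rw [← hf, f.injective.encard_image]

theorem infinite_pIsoClass_subset_pCardinal_univ {α : Type} [Fintype α] [Nonempty α] :
    {C : Set (Set (List α)) |
      (∃ A : Set (List α), C = pIsoClass A) ∧ C ⊆ pCardinal (Set.univ : Set (List α))}.Infinite := by
  choose S hS using fun n : ℕ => Infinite.exists_subset_card_eq (List α) n
  refine Set.infinite_of_injective_forall_mem
    (f := fun n : ℕ => pIsoClass ((S n : Set (List α))ᶜ)) (fun m n h => ?_)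
    fun n => ⟨⟨_, rfl⟩, fun B hB => ?_⟩
  · have h' : PIsomorphic ((S m : Set (List α))ᶜ) ((S n : Set (List α))ᶜ) := by
      have : ((S n : Set (List α))ᶜ) ∈ pIsoClass ((S n : Set (List α))ᶜ) := PIsomorphic.refl _
      exact (Set.ext_iff.1 h _).2 this
    simpa [Set.encard_coe_eq_coe_finsetCard, hS] using h'.encard_compl_eq
  -- Any member of the class has a finite complement too, so the hotel applies to it directly,
  -- without transitivity.
  · refine pEquipollent_univ_of_finite_compl (Set.encard_lt_top_iff.1 ?_)
    rw [← PIsomorphic.encard_compl_eq (show PIsomorphic _ B from hB)]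
    simp

/-! ### Sparse against dense complements -/

section Dense

variable {α : Type} [DecidableEq α] (a b : α)

/-- The first letter of a word that differs from `a`. -/
def firstNe (x : List α) : Option α :=
  x.find? fun c => decide (c ≠ a)

/-- Prepend `a` to the words in `a* b Σ*`. -/
def shift (x : List α) : List α :=
  if firstNe a x = some b then a :: x else x

/-- The inverse of `shift`. -/
def shiftInv (x : List α) : List α :=
  if firstNe a x = some b then x.drop 1 else x

/-- The words that do not consist of `a`s only. -/
def nonPower : Set (List α) :=
  {x | firstNe a x ≠ none}

/-- The words that do not consist of `a`s only and do not begin with `b`. -/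
def nonPowerNonPrefix : Set (List α) :=
  {x | firstNe a x ≠ none ∧ x.head? ≠ some b}

theorem firstNe_cons_self (x : List α) : firstNe a (a :: x) = firstNe a x := by
  simp [firstNe]

theorem isAutomatic_firstNe : IsAutomatic (firstNe a) :=
  isAutomatic_find? _

theorem isAutomaticEdit_shift [Fintype α] : IsAutomaticEdit (shift a b) := by
  refine ⟨_, inferInstance, _, fun q => if q = some b then [a] else [], fun _ => 0,
    isAutomatic_firstNe a, fun x => ?_⟩
  by_cases h : firstNe a x = some b <;> simp [shift, h]

theorem isAutomaticEdit_shiftInv [Fintype α] : IsAutomaticEdit (shiftInv a b) := by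
  refine ⟨_, inferInstance, _, fun q => [], fun q => if q = some b then 1 else 0,
    isAutomatic_firstNe a, fun x => ?_⟩
  by_cases h : firstNe a x = some b <;> simp [shiftInv, h]

variable {a b}

/-- The shift sends `a^k b Σ*` to `a^(k+1) b Σ*` and fixes the other words, so its image misses
precisely `bΣ*`. -/
theorem pEquipollent_nonPower [Fintype α] (hab : a ≠ b) :
    PEquipollent (nonPower a) (nonPowerNonPrefix a b) := by
  have : Inhabited α := ⟨a⟩
  have key (y : List α) (hy : y ∈ nonPowerNonPrefix a b) (h : firstNe a y = some b) :
      ∃ x, y = a :: x ∧ firstNe a x = some b := by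
    rcases y with _ | ⟨c, x⟩
    · simp [firstNe] at h
    · by_cases hc : c = a
      · subst hc
        exact ⟨x, rfl, by rwa [firstNe_cons_self] at h⟩
      · have : c = b := by simpa [firstNe, hc] using h
        exact absurd (by simp [this]) hy.2
  refine pEquipollent_of_isAutomaticEdit (isAutomaticEdit_shift a b) (isAutomaticEdit_shiftInv a b)
    (fun x hx => ?_) (fun y hy => ?_) (fun x hx => ?_) (fun y hy => ?_)
  · unfold shift
    split_ifs with h
    · exact ⟨by rwa [firstNe_cons_self], by simpa using hab⟩
    · refine ⟨hx, fun h' => h ?_⟩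
      obtain ⟨t, rfl⟩ : ∃ t, x = b :: t := by
        cases x <;> simp_all
      simp [firstNe, hab.symm]
  · unfold shiftInv
    split_ifs with h
    · obtain ⟨x, rfl, hx⟩ := key y hy h
      simp [nonPower, hx]
    · exact hy.1
  · unfold shift
    split_ifs with h
    · simp [shiftInv, firstNe_cons_self, h]
    · simp [shiftInv, h]
  · by_cases h : firstNe a y = some b
    · obtain ⟨x, rfl, hx⟩ := key y hy h
      simp [shift, shiftInv, firstNe_cons_self, hx]
    · simp [shift, shiftInv, h]

theorem inEXP_compl_nonPower [Fintype α] : InEXP (nonPower a)ᶜ := by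
  have : Inhabited α := ⟨a⟩
  convert (isAutomatic_firstNe a).inEXP {none} using 1
  ext x
  simp [nonPower]

theorem inEXP_compl_nonPowerNonPrefix [Fintype α] : InEXP (nonPowerNonPrefix a b)ᶜ := by
  have : Inhabited α := ⟨a⟩
  exact ((isAutomatic_firstNe a).prodMk isAutomatic_head?).inEXP
    {q | q.1 ≠ none ∧ q.2 ≠ some b}ᶜ

theorem compl_nonPower_eq : (nonPower a)ᶜ = Set.range fun n => List.replicate n a := by
  ext x
  simp only [nonPower, firstNe, Set.mem_compl_iff, Set.mem_ofPred_eq, not_not, Set.mem_range,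
    List.find?_eq_none, decide_eq_true_eq]
  constructor
  · exact fun h => ⟨x.length, (List.eq_replicate_iff.2 ⟨rfl, h⟩).symm⟩
  · rintro ⟨n, rfl⟩ c hc
    exact List.eq_of_mem_replicate hc

theorem infinite_compl_nonPower : (nonPower a)ᶜ.Infinite := by
  rw [compl_nonPower_eq]
  exact Set.infinite_range_of_injective (List.replicate_left_injective a)

theorem Polynomial.exists_eval_lt_two_pow (p : Polynomial ℕ) : ∃ n, p.eval n < 2 ^ n := by
  have hlog : 0 < Real.log 2 := Real.log_pos one_lt_two
  -- Rescaling by `log 2` turns `2 ^ n` into `exp` at `n * log 2`, where `q` takes the value `p.eval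
  -- n`.
  let q : Polynomial ℝ :=
    (p.map (Nat.castRingHom ℝ)).comp (Polynomial.C (Real.log 2)⁻¹ * Polynomial.X)
  have h := q.tendsto_div_exp_atTop.comp
    (tendsto_natCast_atTop_atTop.const_mul_atTop (α := ℝ) hlog)
  obtain ⟨n, hn⟩ := (h.eventually (gt_mem_nhds one_pos)).exists
  refine ⟨n, ?_⟩
  have e : q.eval (Real.log 2 * n) = (p.eval n : ℕ) := by
    simp [q, Polynomial.eval_comp, inv_mul_cancel_left₀ hlog.ne', Polynomial.eval_natCast_map]
  have e' : Real.exp (Real.log 2 * n) = 2 ^ n := by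
    rw [mul_comm, Real.exp_nat_mul, Real.exp_log two_pos]
  rw [Function.comp_apply, e, e', div_lt_one (by positivity)] at hn
  exact_mod_cast hn

theorem not_pIsomorphic_nonPower (hab : a ≠ b) :
    ¬ PIsomorphic (nonPower a) (nonPowerNonPrefix a b) := by
  intro h
  obtain ⟨f, -, hf, hfc⟩ := h.exists_image_compl
  obtain ⟨p, hp⟩ := hf.exists_length_le
  -- The `2 ^ n` words `b u` with `u ∈ {a, b}^n` lie in the second complement; `f.symm` sends them
  -- to distinct powers of `a`, whose exponents are at most `p.eval (n + 1)`.
  have key (n : ℕ) : 2 ^ n ≤ p.eval (n + 1) + 1 := by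
    let v : (Fin n → Bool) → List α := fun u =>
      b :: List.ofFn fun j => if u j then a else b
    have hv (u) : (v u).length = n + 1 := by simp [v]
    have hvi : Function.Injective v := fun u u' huu => by
      funext j
      have := congrFun (List.ofFn_injective (List.cons.inj huu).2) j
      cases hu : u j <;> cases hu' : u' j <;> simp_all [hab.symm]
    have hmem (u) : ∃ m, List.replicate m a = f.symm (v u) := by
      have : v u ∈ (nonPowerNonPrefix a b)ᶜ := fun h => h.2 rfl
      rw [← hfc] at this
      obtain ⟨x, hx, hxu⟩ := this
      rw [← hxu, f.symm_apply_apply]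
      rwa [compl_nonPower_eq] at hx
    choose m hm using hmem
    have hm' (u) : m u < p.eval (n + 1) + 1 := by
      have := hp (v u)
      rw [← hm, List.length_replicate, hv] at this
      omega
    have := Fintype.card_le_of_injective (fun u => (⟨m u, hm' u⟩ : Fin (p.eval (n + 1) + 1)))
      fun u u' huu => by
        have hmm : m u = m u' := congrArg Fin.val huu
        refine hvi (f.symm.injective ?_)
        rw [← hm, ← hm, hmm]
    simpa using this
  obtain ⟨n, hn⟩ := Polynomial.exists_eval_lt_two_pow (p.comp (Polynomial.X + 1) + 1)
  have := key n
  simp [Polynomial.eval_comp] at hn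
  omega

theorem infinite_compl_nonPowerNonPrefix : (nonPowerNonPrefix a b)ᶜ.Infinite :=
  infinite_compl_nonPower.mono (Set.compl_subset_compl.2 fun _ h => h.1)

end Dense

theorem mainTheorem11 {α : Type} [Fintype α] [Nontrivial α] :
    {C : Set (Set (List α)) |
      (∃ A : Set (List α), C = pIsoClass A) ∧ C ⊆ pCardinal (Set.univ : Set (List α))}.Infinite ∧
    ∃ A B : Set (List α),
      ¬ PIsomorphic A B ∧ PEquipollent A B ∧
      Aᶜ.Infinite ∧ Bᶜ.Infinite ∧ InEXP Aᶜ ∧ InEXP Bᶜ := by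
  classical
  obtain ⟨a, b, hab⟩ := exists_pair_ne α
  exact ⟨infinite_pIsoClass_subset_pCardinal_univ, nonPower a, nonPowerNonPrefix a b,
    not_pIsomorphic_nonPower hab, pEquipollent_nonPower hab, infinite_compl_nonPower,
    infinite_compl_nonPowerNonPrefix, inEXP_compl_nonPower, inEXP_compl_nonPowerNonPrefix⟩
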